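/- Let $\alpha$ be a probability measure on $\mathbb{R}$ with $\int_{\mathbb{R}}\log(1+|x|)\,\alpha(dx)<\infty$ (that is, $\alpha\in FT_1$). For $t>0$ let $\mu(t\alpha)$ denote the law of the almost surely absolutely convergent series $$X_t=\sum_{n=1}^{\infty}W_nB_n,\qquad W_n=Y_n\prod_{k=1}^{n-1}(1-Y_k),$$ where $B_1,Y_1,B_2,Y_2,\ldots$ are independent, $B_n\sim\alpha$ and $Y_n\sim\beta(1,t)(dy)=t(1-y)^{t-1}\mathbf{1}_{(0,1)}(y)\,dy$; equivalently, $X_t=\int x\,P_t(dx)$ for the Dirichlet random probability $P_t=\sum_{n} W_n\delta_{B_n}$ with governing probability $\alpha$ and intensity $t$. Let $0\le b<c$ be real numbers and let $\nu$ be a probability measure on $\mathbb{R}$ such that $\mu(a\alpha)=\nu$ for every $a\in(b,c)$. Then $\alpha=\nu$, and this law is either a Cauchy distribution $$\frac{1}{\pi}\,\frac{\gamma\,dx}{(x-x_0)^2+\gamma^2}\qquad(x_0\in\mathbb{R},\ \gamma>0)$$ or a Dirac mass $\delta_{x_0}$ with $x_0\in\mathbb{R}$. -/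

import Mathlib

open MeasureTheory ProbabilityTheory
open scoped NNReal

/-- The set `FT₁` of probability measures `α` on `ℝ` with `∫ log (1 + |x|) α(dx) < ∞`. -/
def FT1 : Set (Measure ℝ) :=
  {α | IsProbabilityMeasure α ∧ Integrable (fun x : ℝ => Real.log (1 + |x|)) α}

/-- Stick-breaking weights of a sequence `y`, indexed from `0`:
`W n = y n * (1 - y 0) * ⋯ * (1 - y (n - 1))`. -/
def stickWeight (y : ℕ → ℝ) (n : ℕ) : ℝ :=
  y n * ∏ k ∈ Finset.range n, (1 - y k)

/-- The random variable `∑ Wₙ Bₙ`, where `ω n = (Yₙ, Bₙ)`. -/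
noncomputable def dirichletSeries (ω : ℕ → ℝ × ℝ) : ℝ :=
  ∑' n, stickWeight (fun k => (ω k).1) n * (ω n).2

/-- `dirichletMean t α` is the law `μ(tα)` of `∑ Wₙ Bₙ`, the mean `∫ x P_t(dx)` of a Dirichlet
random probability `P_t = ∑ Wₙ δ_{Bₙ}` with governing probability `α` and intensity `t > 0`:
all the `Yₙ` and `Bₙ` are independent, `Yₙ ∼ β(1, t)` and `Bₙ ∼ α`. For `α ∈ FT₁` the series
converges absolutely almost surely. -/
noncomputable def dirichletMean (t : ℝ) (α : Measure ℝ) : Measure ℝ :=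
  (Measure.infinitePi fun _ : ℕ => (betaMeasure 1 t).prod α).map dirichletSeries

/-! Splitting off the first stick gives `X = Y B + (1 - Y) X'` in law, with `X'` an independent copy
of `X`. With `φ`, `ψ` the characteristic functions of `α`, `ν`, this reads `ψ(s) = E[φ(sY) ψ(s(1 -
Y))]` (`charFun_dirichletMean`). Since `1 - Y` has density `a u^(a-1)` on (0,1), invariance over `a
∈ (b,c)` says that the Mellin transform of `u ↦ φ(s(1-u)) ψ(su) - ψ(s)`, cut off at 1, vanishes on a
real interval. Analyticity and Mellin inversion then make this function zero
(`eqOn_zero_of_mellin_Ioo`), so `φ(sy) ψ(s(1-y)) = ψ(s)` for all `y ∈ [0,1]`. Taking `y = 1` gives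
`φ = ψ`, and `ψ` is then multiplicative on the half-line, hence `exp(ks)` there. Hermitian symmetry
and `|ψ| ≤ 1` leave only the Cauchy and Dirac laws. -/

/-! ### Uniqueness for the Mellin transform on (0,1) -/

lemma eqOn_zero_of_mellin_Ioo {h : ℝ → ℂ} (hh : Continuous h) {b c : ℝ} (hb : 0 ≤ b) (hbc : b < c)
    (hz : ∀ a ∈ Set.Ioo b c, ∫ u in Set.Ioo (0 : ℝ) 1, (u : ℂ) ^ ((a : ℂ) - 1) * h u = 0) :
    Set.EqOn h 0 (Set.Ioo 0 1) := by
  set f : ℝ → ℂ := (Set.Iio 1).indicator h with hf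
  have hloc : LocallyIntegrableOn f (Set.Ioi 0) :=
    ((hh.locallyIntegrable (μ := volume)).indicator measurableSet_Iio).locallyIntegrableOn _
  have htop (a : ℝ) : f =O[Filter.atTop] (fun x : ℝ => x ^ (-a)) := by
    refine (Asymptotics.isBigO_zero (E' := ℂ) _ _).congr' ?_ Filter.EventuallyEq.rfl
    filter_upwards [Filter.eventually_ge_atTop 1] with x hx
    simp [hf, hx]
  -- Boundedness at 0 and vanishing beyond 1 make the transform analytic on the whole half-plane `Re
  -- s > 0`.
  have hbot : f =O[nhdsWithin 0 (Set.Ioi 0)] (fun x : ℝ => x ^ (-(0 : ℝ))) := by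
    have h1 : h =O[nhdsWithin 0 (Set.Ioi 0)] (fun _ => (1 : ℝ)) :=
      (hh.tendsto 0).mono_left nhdsWithin_le_nhds |>.isBigO_one ℝ
    refine Asymptotics.IsBigO.trans (Asymptotics.IsBigO.of_bound 1 (.of_forall fun x => ?_))
      (h1.congr_right fun x => by simp)
    simpa [hf] using norm_indicator_le_norm_self h x
  have hconv (s : ℂ) (hs : 0 < s.re) : MellinConvergent f s :=
    mellinConvergent_of_isBigO_rpow hloc (htop (s.re + 1)) (by linarith) hbot hs
  have hdiff : DifferentiableOn ℂ (mellin f) {s | 0 < s.re} := fun s hs =>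
    (mellin_differentiableAt_of_isBigO_rpow hloc (htop (s.re + 1)) (by linarith) hbot
      hs).differentiableWithinAt
  have hopen : IsOpen {s : ℂ | 0 < s.re} := isOpen_lt continuous_const Complex.continuous_re
  have hmel (a : ℝ) (ha : a ∈ Set.Ioo b c) : mellin f a = 0 := by
    rw [← hz a ha, mellin, ← Set.Ioi_inter_Iio, ← setIntegral_indicator measurableSet_Iio]
    refine integral_congr_ae (.of_forall fun x => ?_)
    by_cases hx : x ∈ Set.Iio (1 : ℝ)
    · simp only [hf, Set.indicator_of_mem hx, smul_eq_mul]
    · simp only [hf, Set.indicator_of_notMem hx, smul_zero]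
  have hzero : Set.EqOn (mellin f) 0 {s | 0 < s.re} := by
    set m := (b + c) / 2 with hm
    refine (hdiff.analyticOnNhd hopen).eqOn_zero_of_preconnected_of_frequently_eq_zero
      (z₀ := (m : ℂ)) (convex_halfSpace_re_gt 0).isPreconnected (by simp; linarith) ?_
    have ht : Filter.Tendsto (fun x : ℝ => (x : ℂ)) (nhdsWithin m {m}ᶜ)
        (nhdsWithin (m : ℂ) {(m : ℂ)}ᶜ) :=
      tendsto_nhdsWithin_iff.2 ⟨Complex.continuous_ofReal.continuousAt.tendsto.mono_left
        nhdsWithin_le_nhds, eventually_nhdsWithin_of_forall fun x hx => by simpa using hx⟩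
    refine ht.frequently (Filter.Eventually.frequently ?_)
    filter_upwards [nhdsWithin_le_nhds (Ioo_mem_nhds (show b < m by linarith)
      (show m < c by linarith))] with x hx using hmel x hx
  intro x hx
  -- The transform is zero on the line `Re s = 1`, so its vertical integrability is trivial and
  -- inversion returns 0.
  have hline : ∀ y : ℝ, mellin f ((1 : ℝ) + y * Complex.I) = 0 := fun y => hzero (by simp)
  have hinv := mellinInv_mellin_eq 1 f hx.1 (by simpa using hconv 1 (by simp))
    (by simp only [Complex.VerticalIntegrable, hline]; simp) ?_
  · rw [← Set.indicator_of_mem (show x ∈ Set.Iio 1 from hx.2) h, ← hf, ← hinv]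
    simp only [mellinInv, hline, smul_zero, integral_zero, Pi.zero_apply]
  · refine hh.continuousAt.congr ?_
    filter_upwards [Iio_mem_nhds hx.2] with y hy
    simp [hf, Set.mem_Iio.1 hy]


/-! ### Characteristic function of the Cauchy law -/

open scoped FourierTransform in
lemma fourier_exp_neg_abs {γ : ℝ} (hγ : 0 < γ) (w : ℝ) :
    𝓕 (fun v : ℝ => Complex.exp (-(2 * Real.pi * γ * |v| : ℝ))) w =
      (Real.pi⁻¹ * γ * (w ^ 2 + γ ^ 2)⁻¹ : ℝ) := by
  have hπ := Real.pi_pos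
  set p : ℂ := 2 * Real.pi * γ - 2 * Real.pi * w * Complex.I with hp
  set q : ℂ := -(2 * Real.pi * γ) - 2 * Real.pi * w * Complex.I with hq
  have hpre : 0 < p.re := by simp [hp]; positivity
  have hqre : q.re < 0 := by simp [hq]; positivity
  have hl : Set.EqOn (fun v : ℝ => Complex.exp (↑(-2 * Real.pi * v * w) * Complex.I) •
      Complex.exp (-(2 * Real.pi * γ * |v| : ℝ))) (fun v : ℝ => Complex.exp (p * v))
      (Set.Iic 0) := by
    intro v hv
    simp only [smul_eq_mul, ← Complex.exp_add, abs_of_nonpos (Set.mem_Iic.1 hv), hp]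
    congr 1; push_cast; ring
  have hr : Set.EqOn (fun v : ℝ => Complex.exp (↑(-2 * Real.pi * v * w) * Complex.I) •
      Complex.exp (-(2 * Real.pi * γ * |v| : ℝ))) (fun v : ℝ => Complex.exp (q * v))
      (Set.Ioi 0) := by
    intro v hv
    simp only [smul_eq_mul, ← Complex.exp_add, abs_of_pos (Set.mem_Ioi.1 hv), hq]
    congr 1; push_cast; ring
  rw [Real.fourier_real_eq_integral_exp_smul, ← intervalIntegral.integral_Iic_add_Ioi (b := 0)
    ((integrableOn_exp_mul_complex_Iic hpre 0).congr_fun hl.symm measurableSet_Iic)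
    ((integrableOn_exp_mul_complex_Ioi hqre 0).congr_fun hr.symm measurableSet_Ioi),
    setIntegral_congr_fun measurableSet_Iic hl, setIntegral_congr_fun measurableSet_Ioi hr,
    integral_exp_mul_complex_Iic hpre, integral_exp_mul_complex_Ioi hqre]
  have hp0 : p ≠ 0 := fun h => by simp [h] at hpre
  have hq0 : q ≠ 0 := fun h => by simp [h] at hqre
  have hw : (w : ℂ) ^ 2 + (γ : ℂ) ^ 2 ≠ 0 := by
    exact_mod_cast (by positivity : w ^ 2 + γ ^ 2 ≠ 0)
  have hπ' : (Real.pi : ℂ) ≠ 0 := by exact_mod_cast hπ.ne'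
  have hpq : p * q = -4 * Real.pi ^ 2 * (w ^ 2 + γ ^ 2) := by
    rw [hp, hq]; linear_combination (4 * Real.pi ^ 2 * w ^ 2 : ℂ) * Complex.I_sq
  have hqp : q - p = -4 * Real.pi * γ := by rw [hp, hq]; ring
  have : Complex.exp (p * (0 : ℝ)) / p + -Complex.exp (q * (0 : ℝ)) / q = (q - p) / (p * q) := by
    field_simp
    simp
    ring
  rw [this, hpq, hqp]
  push_cast
  field_simp

open scoped FourierTransform in
-- Fourier inversion of the preceding transform, at frequency `s / (2π)`; the translation by `x₀`
-- contributes the phase.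
lemma charFun_cauchyMeasure (x₀ : ℝ) {γ : ℝ≥0} (hγ : 0 < γ) (s : ℝ) :
    charFun (cauchyMeasure x₀ γ) s = Complex.exp (s * x₀ * Complex.I - γ * |s|) := by
  have hγ' : (0 : ℝ) < γ := hγ
  have hπ := Real.pi_pos
  set f : ℝ → ℂ := fun v => Complex.exp (-(2 * Real.pi * γ * |v| : ℝ)) with hf
  have hfc : Continuous f := by fun_prop
  have hFf : 𝓕 f = fun w => ((cauchyPDFReal 0 γ w : ℝ) : ℂ) := by
    ext w
    rw [hf, fourier_exp_neg_abs hγ', cauchyPDFReal, sub_zero]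
  have hfi : Integrable f := by
    have hc : 0 < 2 * Real.pi * γ := by positivity
    have : Integrable (fun v : ℝ => Real.exp (-(2 * Real.pi * γ * |v|))) := by
      rw [← integrableOn_univ, ← Set.Iic_union_Ioi (a := (0 : ℝ))]
      refine ((integrableOn_exp_mul_Iic hc 0).congr_fun (fun v hv => ?_) measurableSet_Iic).union
        ((integrableOn_exp_mul_Ioi (neg_lt_zero.2 hc) 0).congr_fun (fun v hv => ?_)
          measurableSet_Ioi)
      · simp only [abs_of_nonpos (Set.mem_Iic.1 hv), mul_neg, neg_neg]
      · simp only [abs_of_pos (Set.mem_Ioi.1 hv), neg_mul]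
    convert this.ofReal (𝕜 := ℂ) using 2
    simp [hf]
  have hinv := congrFun (hfc.fourierInv_fourier_eq hfi
    (by rw [hFf]; exact (integrable_cauchyPDFReal 0).ofReal)) (s / (2 * Real.pi))
  rw [hFf, Real.fourierInv_eq'] at hinv
  rw [charFun_apply_real, cauchyMeasure_of_scale_ne_zero x₀ hγ.ne']
  have hpdf : cauchyPDF x₀ γ = fun x => ((Real.toNNReal (cauchyPDFReal x₀ γ x) : ℝ≥0) : ENNReal) :=
    rfl
  rw [hpdf, integral_withDensity_eq_integral_smul (by fun_prop),
    ← integral_add_right_eq_self _ x₀]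
  calc _ = ∫ v : ℝ, Complex.exp (s * x₀ * Complex.I) *
        (Complex.exp (↑(2 * Real.pi * inner ℝ v (s / (2 * Real.pi))) * Complex.I) •
          ((cauchyPDFReal 0 γ v : ℝ) : ℂ)) := by
        refine integral_congr_ae (.of_forall fun v => ?_)
        have h1 : cauchyPDFReal x₀ γ (v + x₀) = cauchyPDFReal 0 γ v := by simp [cauchyPDFReal]
        simp only [NNReal.smul_def, h1, Real.coe_toNNReal _ (cauchyPDF_pos 0 hγ.ne' v).le,
          smul_eq_mul, Complex.real_smul]
        rw [← mul_assoc, ← Complex.exp_add, mul_comm]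
        congr 2
        simp
        field_simp
        ring
    _ = _ := by
        rw [integral_const_mul, hinv, hf, ← Complex.exp_add]
        congr 1
        rw [abs_div, abs_of_pos (show 0 < 2 * Real.pi by positivity)]
        push_cast
        field_simp
        ring

/-! ### Shift structure of i.i.d. sequences -/

/-- Prepend a term to a sequence. -/
def consSeq {E : Type*} (p : E × (ℕ → E)) : ℕ → E :=
  fun n => Nat.casesOn n p.1 p.2

@[simp]
lemma consSeq_zero {E : Type*} (p : E × (ℕ → E)) : consSeq p 0 = p.1 := rfl

@[simp]
lemma consSeq_succ {E : Type*} (p : E × (ℕ → E)) (n : ℕ) : consSeq p (n + 1) = p.2 n := rfl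

lemma measurable_consSeq {E : Type*} [MeasurableSpace E] :
    Measurable (consSeq : E × (ℕ → E) → ℕ → E) := by
  refine measurable_pi_lambda _ fun n => ?_
  cases n with
  | zero => exact measurable_fst
  | succ n => exact (measurable_pi_apply n).comp measurable_snd

lemma infinitePi_map_consSeq {E : Type*} [MeasurableSpace E] (ρ : Measure E)
    [IsProbabilityMeasure ρ] :
    (ρ.prod (Measure.infinitePi fun _ : ℕ => ρ)).map consSeq =
      Measure.infinitePi fun _ : ℕ => ρ := by
  refine Measure.eq_infinitePi _ fun s t ht => ?_
  classical
  set s' : Finset ℕ := s.preimage Nat.succ (Nat.succ_injective.injOn) with hs'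
  -- `A` is the constraint on coordinate 0, void when the box does not involve it.
  set A : Set E := if 0 ∈ s then t 0 else Set.univ with hA
  have hAm : MeasurableSet A := by rw [hA]; split_ifs; exacts [ht 0, .univ]
  have hpre : consSeq ⁻¹' (Set.pi s t) = A ×ˢ Set.pi s' (fun n => t (n + 1)) := by
    ext ⟨x, ω⟩
    simp only [Set.mem_preimage, Set.mem_pi, Set.mem_prod, hA, hs']
    constructor
    · intro h
      refine ⟨?_, fun n hn => h (n + 1) (by simpa using hn)⟩
      split_ifs with h0
      · exact h 0 h0
      · trivial
    · rintro ⟨h0, h1⟩ n hn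
      cases n with
      | zero => simpa [show 0 ∈ s from hn] using h0
      | succ n => exact h1 n (by simpa using hn)
  rw [Measure.map_apply measurable_consSeq (.pi s.countable_toSet fun i _ => ht i), hpre,
    Measure.prod_prod, Measure.infinitePi_pi _ fun i _ => ht (i + 1)]
  have hprod : ∏ i ∈ s', ρ (t (i + 1)) = ∏ i ∈ s.erase 0, ρ (t i) := by
    refine Finset.prod_bij (fun i _ => i + 1) ?_ ?_ ?_ ?_
    · intro i hi; simpa [hs'] using hi
    · intro i _ j _ h; simpa using h
    · intro j hj
      obtain ⟨k, rfl⟩ := Nat.exists_eq_succ_of_ne_zero (Finset.ne_of_mem_erase hj)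
      exact ⟨k, by simpa [hs'] using Finset.mem_of_mem_erase hj, rfl⟩
    · intro i _; rfl
  rw [hprod, hA]
  split_ifs with h0
  · exact Finset.mul_prod_erase s (fun i => ρ (t i)) h0
  · simp [Finset.erase_eq_of_notMem h0]

lemma lintegral_prod_range_infinitePi {E : Type*} [MeasurableSpace E] (ρ : Measure E)
    [IsProbabilityMeasure ρ] {g : E → ENNReal} (hg : Measurable g) (n : ℕ) :
    ∫⁻ ω, ∏ k ∈ Finset.range n, g (ω k) ∂(Measure.infinitePi fun _ : ℕ => ρ) =
      (∫⁻ x, g x ∂ρ) ^ n := by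
  induction n with
  | zero => simp
  | succ n ih =>
    rw [← infinitePi_map_consSeq, lintegral_map (by fun_prop) measurable_consSeq]
    simp only [Finset.prod_range_succ', consSeq_zero, consSeq_succ]
    rw [lintegral_prod _ (by fun_prop)]
    simp only
    calc _ = ∫⁻ x, (∫⁻ x, g x ∂ρ) ^ n * g x ∂ρ := by
          refine lintegral_congr fun x => ?_
          rw [lintegral_mul_const _ (by fun_prop), ih]
      _ = _ := by rw [lintegral_const_mul _ hg, pow_succ]

lemma dirichletSeries_consSeq {ω : ℕ → ℝ × ℝ}
    (h : Summable fun n => stickWeight (fun k => (ω k).1) n * (ω n).2) (x : ℝ × ℝ) :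
    dirichletSeries (consSeq (x, ω)) = x.1 * x.2 + (1 - x.1) * dirichletSeries ω := by
  have hs (n : ℕ) : stickWeight (fun k => (consSeq (x, ω) k).1) (n + 1) *
      (consSeq (x, ω) (n + 1)).2 =
      (1 - x.1) * (stickWeight (fun k => (ω k).1) n * (ω n).2) := by
    simp only [stickWeight, consSeq_zero, consSeq_succ, Finset.prod_range_succ']
    ring
  rw [dirichletSeries, Summable.tsum_eq_zero_add]
  · simp_rw [hs, tsum_mul_left]
    simp [stickWeight, consSeq_zero, dirichletSeries]
  · rw [← summable_nat_add_iff 1]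
    simp_rw [hs]
    exact h.mul_left _

/-! ### Almost sure convergence of the series -/

lemma measurable_stickWeight_mul (n : ℕ) :
    Measurable fun ω : ℕ → ℝ × ℝ => stickWeight (fun k => (ω k).1) n * (ω n).2 := by
  unfold stickWeight
  fun_prop

lemma ae_mem_Ioo_betaMeasure (p q : ℝ) : ∀ᵐ y ∂betaMeasure p q, y ∈ Set.Ioo (0 : ℝ) 1 := by
  rw [betaMeasure, ae_withDensity_iff (by unfold betaPDF; fun_prop)]
  refine .of_forall fun y hy => ?_
  by_contra h
  refine hy ?_
  rw [betaPDF_eq, if_neg (by simpa using h), ENNReal.ofReal_zero]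

lemma ae_forall_infinitePi {E : Type*} [MeasurableSpace E] {ρ : Measure E}
    [IsProbabilityMeasure ρ] {p : E → Prop} (h : ∀ᵐ x ∂ρ, p x) :
    ∀ᵐ ω ∂(Measure.infinitePi fun _ : ℕ => ρ), ∀ n, p (ω n) :=
  ae_all_iff.2 fun n =>
    (measurePreserving_eval_infinitePi (fun _ : ℕ => ρ) n).quasiMeasurePreserving.ae h

/-- Borel–Cantelli: the probabilities of `log (1 + |f|) / δ > n` are summable because the variable
is integrable. -/
lemma ae_eventually_abs_le_exp {E : Type*} [MeasurableSpace E] {ρ : Measure E}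
    [IsProbabilityMeasure ρ] {f : E → ℝ} (hf : Measurable f)
    (h : Integrable (fun x => Real.log (1 + |f x|)) ρ) {δ : ℝ} (hδ : 0 < δ) :
    ∀ᵐ ω ∂(Measure.infinitePi fun _ : ℕ => ρ), ∀ᶠ n : ℕ in Filter.atTop,
      |f (ω n)| ≤ Real.exp δ ^ n := by
  let : MeasureSpace E := ⟨ρ⟩
  have : IsProbabilityMeasure (volume : Measure E) := ‹IsProbabilityMeasure ρ›
  have hsum := tsum_prob_mem_Ioi_lt_top (X := fun x => Real.log (1 + |f x|) / δ) (h.div_const δ)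
    (fun x => div_nonneg (Real.log_nonneg (by linarith [abs_nonneg (f x)])) hδ.le)
  set s : ℕ → Set (ℕ → E) := fun n => {ω | Real.log (1 + |f (ω n)|) / δ ∈ Set.Ioi (n : ℝ)}
  have hs (n : ℕ) : Measure.infinitePi (fun _ : ℕ => ρ) (s n) =
      ρ {x | Real.log (1 + |f x|) / δ ∈ Set.Ioi (n : ℝ)} :=
    (measurePreserving_eval_infinitePi (fun _ : ℕ => ρ) n).measure_preimage
      ((by fun_prop : Measurable fun x => Real.log (1 + |f x|) / δ)
        measurableSet_Ioi).nullMeasurableSet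
  have := ae_eventually_notMem (μ := Measure.infinitePi (fun _ : ℕ => ρ)) (s := s)
    (by simp_rw [hs]; exact hsum.ne)
  filter_upwards [this] with ω hω
  filter_upwards [hω] with n hn
  have h1 : Real.log (1 + |f (ω n)|) ≤ n * δ := by
    rw [← div_le_iff₀ hδ]; simpa [s] using hn
  have h2 := (Real.log_le_iff_le_exp (by positivity)).1 h1
  rw [Real.exp_nat_mul] at h2
  linarith

/-- Let `r = E[1 - Y] < 1` and choose `δ > 0` with `e^δ r < 1`. Then `∑ e^(δn) ∏_{k<n} (1 - Y_k)`
has finite expectation, and it eventually dominates the series termwise since `|B_n| ≤ e^(δn)` for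
large `n`. -/
lemma ae_summable_stickWeight_mul {t : ℝ} (ht : 0 < t) {α : Measure ℝ} (hα : α ∈ FT1) :
    ∀ᵐ ω ∂(Measure.infinitePi fun _ : ℕ => (betaMeasure 1 t).prod α),
      Summable fun n => stickWeight (fun k => (ω k).1) n * (ω n).2 := by
  have := hα.1
  have := isProbabilityMeasureBeta one_pos ht
  set ρ := (betaMeasure 1 t).prod α with hρ
  have hY : ∀ᵐ x ∂ρ, x.1 ∈ Set.Ioo (0 : ℝ) 1 :=
    Measure.quasiMeasurePreserving_fst.ae (ae_mem_Ioo_betaMeasure 1 t)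
  set g : ℝ × ℝ → ENNReal := fun x => ENNReal.ofReal (1 - x.1) with hg
  have hgm : Measurable g := by fun_prop
  set r := ∫⁻ x, g x ∂ρ with hr
  have hgle : ∫⁻ x, g x ∂ρ ≤ ∫⁻ _, 1 ∂ρ := lintegral_mono_ae <| hY.mono fun x hx => by
    simpa [hg] using hx.1.le
  have hr1 : r < 1 := by
    have := lintegral_strict_mono (μ := ρ) (f := g) (g := fun _ => 1)
      (IsProbabilityMeasure.ne_zero ρ) (by fun_prop) (ne_top_of_le_ne_top (by simp) hgle)
      (hY.mono fun x hx => by simpa [hg] using hx.1)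
    simpa using this
  obtain ⟨δ, hδ, hδr⟩ : ∃ δ : ℝ, 0 < δ ∧ ENNReal.ofReal (Real.exp δ) * r < 1 := by
    have hcont : Filter.Tendsto (fun δ : ℝ => ENNReal.ofReal (Real.exp δ) * r)
        (nhdsWithin 0 (Set.Ioi 0)) (nhds (1 * r)) := by
      refine ENNReal.Tendsto.mul_const ?_ (Or.inl one_ne_zero)
      have : Continuous fun δ : ℝ => ENNReal.ofReal (Real.exp δ) :=
        ENNReal.continuous_ofReal.comp Real.continuous_exp
      simpa using (this.tendsto 0).mono_left nhdsWithin_le_nhds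
    rw [one_mul] at hcont
    obtain ⟨δ, h1, h2⟩ := ((hcont.eventually_lt_const hr1).and self_mem_nhdsWithin).exists
    exact ⟨δ, h2, h1⟩
  have hfin : ∑' n : ℕ, ∫⁻ ω, ∏ k ∈ Finset.range n, (ENNReal.ofReal (Real.exp δ) * g (ω k))
      ∂(Measure.infinitePi fun _ : ℕ => ρ) ≠ ⊤ := by
    simp_rw [lintegral_prod_range_infinitePi ρ (hgm.const_mul _), lintegral_const_mul _ hgm]
    rw [ENNReal.tsum_geometric, ENNReal.inv_ne_top]
    exact (tsub_pos_of_lt hδr).ne'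
  have hm (n : ℕ) : Measurable fun ω : ℕ → ℝ × ℝ =>
      ∏ k ∈ Finset.range n, (ENNReal.ofReal (Real.exp δ) * g (ω k)) :=
    Finset.measurable_prod _ fun k _ => (hgm.comp (measurable_pi_apply k)).const_mul _
  rw [← lintegral_tsum fun n => (hm n).aemeasurable] at hfin
  have hB := ae_eventually_abs_le_exp (ρ := ρ) measurable_snd
    (hα.2.comp_snd (betaMeasure 1 t)) hδ
  filter_upwards [ae_lt_top (.tsum hm) hfin, hB, ae_forall_infinitePi hY] with ω h1 h2 h3
  have hsum := ENNReal.summable_toReal h1.ne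
  refine Summable.of_norm_bounded_eventually_nat hsum ?_
  filter_upwards [h2] with n hn
  have hprod : 0 ≤ ∏ k ∈ Finset.range n, (1 - (ω k).1) :=
    Finset.prod_nonneg fun k _ => by linarith [(h3 k).2]
  have : (∏ k ∈ Finset.range n, (ENNReal.ofReal (Real.exp δ) * g (ω k))).toReal =
      Real.exp δ ^ n * ∏ k ∈ Finset.range n, (1 - (ω k).1) := by
    rw [ENNReal.toReal_prod, Finset.prod_congr rfl (g := fun k => Real.exp δ * (1 - (ω k).1)),
      Finset.prod_mul_distrib]
    · simp
    · intro k _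
      rw [ENNReal.toReal_mul, ENNReal.toReal_ofReal (Real.exp_pos δ).le,
        ENNReal.toReal_ofReal (by linarith [(h3 k).2])]
  rw [this, norm_mul, stickWeight, norm_mul, Real.norm_of_nonneg hprod,
    Real.norm_of_nonneg (h3 n).1.le, mul_comm]
  refine mul_le_mul hn (mul_le_of_le_one_left hprod (h3 n).2.le) (by have := (h3 n).1.le; positivity)
    (by positivity)

lemma aemeasurable_dirichletSeries {t : ℝ} (ht : 0 < t) {α : Measure ℝ} (hα : α ∈ FT1) :
    AEMeasurable dirichletSeries (Measure.infinitePi fun _ : ℕ => (betaMeasure 1 t).prod α) := by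
  refine aemeasurable_of_tendsto_metrizable_ae Filter.atTop
    (f := fun (N : ℕ) ω => ∑ n ∈ Finset.range N, stickWeight (fun k => (ω k).1) n * (ω n).2)
    (fun N => (Finset.measurable_sum _ fun n _ => measurable_stickWeight_mul n).aemeasurable) ?_
  filter_upwards [ae_summable_stickWeight_mul ht hα] with ω hω using hω.hasSum.tendsto_sum_nat

lemma isProbabilityMeasure_dirichletMean {t : ℝ} (ht : 0 < t) {α : Measure ℝ} (hα : α ∈ FT1) :
    IsProbabilityMeasure (dirichletMean t α) := by
  have := hα.1
  have := isProbabilityMeasureBeta one_pos ht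
  exact Measure.isProbabilityMeasure_map (aemeasurable_dirichletSeries ht hα)

/-! ### The distributional equation and its Mellin form -/

lemma charFun_dirichletMean {t : ℝ} (ht : 0 < t) {α : Measure ℝ} (hα : α ∈ FT1) (s : ℝ) :
    charFun (dirichletMean t α) s =
      ∫ y, charFun α (s * y) * charFun (dirichletMean t α) (s * (1 - y)) ∂betaMeasure 1 t := by
  have := hα.1
  have := isProbabilityMeasureBeta one_pos ht
  set ρ := (betaMeasure 1 t).prod α with hρ
  set P := Measure.infinitePi fun _ : ℕ => ρ with hP
  have hX : AEMeasurable dirichletSeries P := aemeasurable_dirichletSeries ht hα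
  have hchar (s : ℝ) : charFun (dirichletMean t α) s =
      ∫ ω, Complex.exp (s * dirichletSeries ω * Complex.I) ∂P := by
    rw [charFun_apply_real, dirichletMean, integral_map hX (by fun_prop)]
  have hX' : AEMeasurable dirichletSeries ((ρ.prod P).map consSeq) := by
    rwa [hP, infinitePi_map_consSeq]
  have hsplit : ∫ ω, Complex.exp (s * dirichletSeries ω * Complex.I) ∂P =
      ∫ z, Complex.exp (s * (z.1.1 * z.1.2) * Complex.I) *
        Complex.exp (↑(s * (1 - z.1.1)) * dirichletSeries z.2 * Complex.I) ∂(ρ.prod P) := by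
    -- Realize the sequence as a first pair followed by an independent copy of the whole sequence.
    conv_lhs => rw [hP, ← infinitePi_map_consSeq, ← hP]
    rw [integral_map measurable_consSeq.aemeasurable
      (by have := hX'.aestronglyMeasurable; fun_prop)]
    refine integral_congr_ae ?_
    have hs : ∀ᵐ z ∂(ρ.prod P), Summable fun n => stickWeight (fun k => (z.2 k).1) n * (z.2 n).2 :=
      Measure.quasiMeasurePreserving_snd.ae (ae_summable_stickWeight_mul ht hα)
    filter_upwards [hs] with z hz
    rw [← Complex.exp_add, show z = (z.1, z.2) from rfl, dirichletSeries_consSeq hz]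
    congr 1; push_cast; ring
  have hX2 : AEMeasurable (fun z : (ℝ × ℝ) × (ℕ → ℝ × ℝ) => dirichletSeries z.2) (ρ.prod P) :=
    hX.comp_quasiMeasurePreserving Measure.quasiMeasurePreserving_snd
  rw [hchar, hsplit, integral_prod]
  · simp_rw [integral_const_mul, ← hchar]
    rw [hρ, integral_prod]
    · simp_rw [integral_mul_const]
      refine integral_congr_ae (.of_forall fun y => ?_)
      simp only
      rw [charFun_apply_real (μ := α)]
      congr 2
      ext b
      push_cast
      ring_nf
    · have := isProbabilityMeasure_dirichletMean ht hα
      have hc : Continuous (charFun (dirichletMean t α)) := continuous_charFun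
      refine Integrable.of_bound (by fun_prop) 1 (.of_forall fun x => ?_)
      rw [norm_mul]
      exact mul_le_one₀ (by rw [← Complex.ofReal_mul, ← Complex.ofReal_mul,
        Complex.norm_exp_ofReal_mul_I]) (norm_nonneg _) (norm_charFun_le_one _)
  · refine Integrable.of_bound (by fun_prop) 1 (.of_forall fun z => ?_)
    rw [norm_mul, ← Complex.ofReal_mul, ← Complex.ofReal_mul, ← Complex.ofReal_mul,
      Complex.norm_exp_ofReal_mul_I, Complex.norm_exp_ofReal_mul_I, one_mul]

/-- The substitution `u = 1 - y` turns the beta density into the Mellin kernel. -/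
lemma integral_betaMeasure_one {t : ℝ} (ht : 0 < t) (g : ℝ → ℂ) :
    ∫ y, g y ∂betaMeasure 1 t =
      (1 / beta 1 t : ℝ) * ∫ u in Set.Ioo (0 : ℝ) 1, (u : ℂ) ^ ((t : ℂ) - 1) * g (1 - u) := by
  have hpdf : betaPDF 1 t = fun y => ((Real.toNNReal (betaPDFReal 1 t y) : ℝ≥0) : ENNReal) := rfl
  rw [betaMeasure, hpdf, integral_withDensity_eq_integral_smul (by fun_prop),
    ← integral_sub_left_eq_self _ volume 1, ← integral_const_mul,
    ← integral_indicator measurableSet_Ioo]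
  refine integral_congr_ae (.of_forall fun u => ?_)
  simp only
  by_cases hu : u ∈ Set.Ioo (0 : ℝ) 1
  · have hpos := betaPDFReal_pos (x := 1 - u) (by linarith [hu.2]) (by linarith [hu.1]) one_pos ht
    rw [Set.indicator_of_mem hu, NNReal.smul_def, Real.coe_toNNReal _ hpos.le, Complex.real_smul,
      betaPDFReal, if_pos ⟨by linarith [hu.2], by linarith [hu.1]⟩, sub_sub_cancel, sub_self,
      Real.rpow_zero, mul_one, Complex.ofReal_mul, Complex.ofReal_cpow hu.1.le]
    push_cast
    ring
  · rw [Set.indicator_of_notMem hu, betaPDFReal, if_neg, Real.toNNReal_zero, zero_smul]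
    exact fun h => hu ⟨by linarith [h.2], by linarith [h.1]⟩

lemma charFun_mul_charFun_of_dirichletMean_eq {α : Measure ℝ} (hα : α ∈ FT1) {b c : ℝ} (hb : 0 ≤ b)
    (hbc : b < c) {ν : Measure ℝ} (hν : ∀ a ∈ Set.Ioo b c, dirichletMean a α = ν)
    (s : ℝ) {y : ℝ} (hy : y ∈ Set.Icc (0 : ℝ) 1) :
    charFun α (s * y) * charFun ν (s * (1 - y)) = charFun ν s := by
  have := hα.1
  have hνp : IsProbabilityMeasure ν := by
    obtain ⟨a, ha⟩ := exists_between hbc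
    rw [← hν a ha]
    exact isProbabilityMeasure_dirichletMean (hb.trans_lt ha.1) hα
  have hcα : Continuous (charFun α) := continuous_charFun
  have hcν : Continuous (charFun ν) := continuous_charFun
  set h : ℝ → ℂ := fun u => charFun α (s * (1 - u)) * charFun ν (s * u) - charFun ν s with hh
  have hhc : Continuous h := by fun_prop
  have hz : ∀ a ∈ Set.Ioo b c, ∫ u in Set.Ioo (0 : ℝ) 1, (u : ℂ) ^ ((a : ℂ) - 1) * h u = 0 := by
    intro a ha
    have ha0 : 0 < a := hb.trans_lt ha.1
    have := isProbabilityMeasureBeta one_pos ha0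
    have hint : Integrable (fun y => charFun α (s * y) * charFun ν (s * (1 - y)))
        (betaMeasure 1 a) := by
      refine Integrable.of_bound (by fun_prop) 1 (.of_forall fun y => ?_)
      rw [norm_mul]
      exact mul_le_one₀ (norm_charFun_le_one _) (norm_nonneg _) (norm_charFun_le_one _)
    have h1 : ∫ y, h (1 - y) ∂betaMeasure 1 a = 0 := by
      simp only [hh, sub_sub_cancel]
      rw [integral_sub hint (integrable_const _), integral_const, probReal_univ, one_smul]
      have := charFun_dirichletMean ha0 hα s
      rw [hν a ha] at this
      rw [← this, sub_self]
    rw [integral_betaMeasure_one ha0] at h1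
    simp only [sub_sub_cancel] at h1
    refine (mul_eq_zero.1 h1).resolve_left ?_
    exact_mod_cast (one_div_pos.2 (beta_pos one_pos ha0)).ne'
  have hzero := eqOn_zero_of_mellin_Ioo hhc hb hbc hz
  have hcl : Set.EqOn h 0 (Set.Icc 0 1) := by
    rw [← closure_Ioo (zero_ne_one' ℝ)]
    exact hzero.closure hhc continuous_zero
  have := hcl (show 1 - y ∈ Set.Icc (0 : ℝ) 1 from ⟨by linarith [hy.2], by linarith [hy.1]⟩)
  simpa [hh, sub_eq_zero] using this

/-! ### Multiplicative characteristic functions and the conclusion -/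

/-- Integrating the functional equation over `[0, δ]` writes `φ` through its primitive `F`, so
continuity upgrades to differentiability and `φ' = kφ` follows. Derivatives are one-sided because
the equation is only known on the half-line. -/
lemma exists_eq_exp_of_map_add {φ : ℝ → ℂ} (hc : Continuous φ) (h0 : φ 0 = 1)
    (hadd : ∀ s t, 0 ≤ s → 0 ≤ t → φ (s + t) = φ s * φ t) :
    ∃ k : ℂ, ∀ s, 0 ≤ s → φ s = Complex.exp (k * s) := by
  have hder (x : ℝ) : HasDerivAt (fun x => ∫ u in (0 : ℝ)..x, φ u) (φ x) x :=
    intervalIntegral.integral_hasDerivAt_right (hc.intervalIntegrable _ _)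
      (hc.stronglyMeasurableAtFilter _ _) hc.continuousAt
  set F : ℝ → ℂ := fun x => ∫ u in (0 : ℝ)..x, φ u with hF
  -- If `F` vanished on the positive half-line, its right derivative at 0 would be 0 instead of `φ 0
  -- = 1`.
  obtain ⟨δ, hδ, hK⟩ : ∃ δ : ℝ, 0 < δ ∧ F δ ≠ 0 := by
    by_contra! hall
    have h1 : HasDerivWithinAt F 0 (Set.Ici 0) 0 :=
      (hasDerivWithinAt_const (0 : ℝ) (Set.Ici 0) (0 : ℂ)).congr (fun x hx => by
        rcases (Set.mem_Ici.1 hx).eq_or_lt with rfl | hx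
        · simp [hF]
        · exact hall x hx) (by simp [hF])
    have := (uniqueDiffWithinAt_Ici (0 : ℝ)).eq_deriv _ (hder 0).hasDerivWithinAt h1
    rw [h0] at this
    exact one_ne_zero this
  have hrep (s : ℝ) (hs : 0 ≤ s) : φ s = (F (s + δ) - F s) / F δ := by
    rw [eq_div_iff hK, hF, intervalIntegral.integral_interval_sub_left
      (hc.intervalIntegrable _ _) (hc.intervalIntegrable _ _)]
    rw [← intervalIntegral.integral_const_mul]
    have hshift := intervalIntegral.integral_comp_add_left φ s (a := 0) (b := δ)
    rw [add_zero] at hshift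
    rw [← hshift]
    refine intervalIntegral.integral_congr fun u hu => ?_
    rw [Set.uIcc_of_le hδ.le] at hu
    exact (hadd s u hs hu.1).symm
  set k := (φ δ - 1) / F δ with hk
  have hφ (x : ℝ) (hx : 0 ≤ x) : HasDerivWithinAt φ (k * φ x) (Set.Ici x) x := by
    have h1 : HasDerivAt (fun s => (F (s + δ) - F s) / F δ) ((φ (x + δ) - φ x) / F δ) x :=
      (((hder (x + δ)).comp_add_const x δ).sub (hder x)).div_const _
    refine (h1.hasDerivWithinAt.congr (fun y hy => hrep y (hx.trans hy)) (hrep x hx)).congr_deriv ?_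
    rw [hadd x δ hx hδ.le, hk]
    ring
  refine ⟨k, fun s hs => ?_⟩
  have hconst := constant_of_has_deriv_right_zero
    (f := fun x : ℝ => φ x * Complex.exp (-k * x)) (a := 0) (b := s) (by fun_prop)
    (fun x hx => by
      have he : HasDerivAt (fun x : ℝ => Complex.exp (-k * x))
          (Complex.exp (-k * x) * (-k * 1)) x :=
        ((hasDerivAt_id (x : ℂ)).const_mul (-k)).cexp.comp_ofReal
      refine ((hφ x hx.1).mul he.hasDerivWithinAt).congr_deriv ?_
      ring) s ⟨hs, le_rfl⟩
  simp only [h0, Complex.ofReal_zero, mul_zero, Complex.exp_zero, mul_one, neg_mul,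
    Complex.exp_neg] at hconst
  rwa [mul_inv_eq_one₀ (Complex.exp_ne_zero _)] at hconst

lemma eq_cauchyMeasure_or_dirac_of_charFun_add {ν : Measure ℝ} [IsProbabilityMeasure ν]
    (hadd : ∀ s t, 0 ≤ s → 0 ≤ t → charFun ν (s + t) = charFun ν s * charFun ν t) :
    (∃ (x₀ : ℝ) (γ : ℝ≥0), 0 < γ ∧ ν = cauchyMeasure x₀ γ) ∨ ∃ x₀ : ℝ, ν = Measure.dirac x₀ := by
  obtain ⟨k, hk⟩ := exists_eq_exp_of_map_add continuous_charFun (by simp [charFun_zero]) hadd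
  have hre : 0 ≤ -k.re := by
    have h1 := norm_charFun_le_one (μ := ν) (t := (1 : ℝ))
    rw [hk 1 zero_le_one, Complex.norm_exp, Real.exp_le_one_iff] at h1
    simp at h1
    linarith
  have hkey (s : ℝ) : charFun ν s =
      Complex.exp (s * k.im * Complex.I - (-k.re : ℝ) * |s|) := by
    have hpos (s : ℝ) (hs : 0 ≤ s) : charFun ν s =
        Complex.exp (s * k.im * Complex.I - (-k.re : ℝ) * |s|) := by
      rw [hk s hs, abs_of_nonneg hs]
      congr 1
      conv_lhs => rw [← Complex.re_add_im k]
      push_cast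
      ring
    rcases le_total 0 s with hs | hs
    · exact hpos s hs
    -- Negative arguments follow by conjugation, which is where `|s|` comes from.
    · rw [← neg_neg s, charFun_neg, hpos (-s) (by linarith), ← Complex.exp_conj]
      congr 1
      simp
  rcases hre.eq_or_lt with h | h
  -- The location is `Im k` and the scale `-Re k`; scale 0 is the Dirac case.
  · refine Or.inr ⟨k.im, Measure.ext_of_charFun ?_⟩
    ext s
    rw [hkey, ← h, charFun_dirac]
    congr 1
    simp
  · obtain ⟨γ, hγ⟩ : ∃ γ : ℝ≥0, (γ : ℝ) = -k.re := ⟨⟨-k.re, hre⟩, rfl⟩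
    have hγ0 : 0 < γ := by rw [← NNReal.coe_pos, hγ]; exact h
    have : IsProbabilityMeasure (cauchyMeasure k.im γ) := ⟨by
      rw [cauchyMeasure_of_scale_ne_zero _ hγ0.ne', withDensity_apply _ .univ,
        Measure.restrict_univ, lintegral_cauchyPDF_eq_one _ hγ0.ne']⟩
    refine Or.inl ⟨k.im, γ, hγ0, Measure.ext_of_charFun ?_⟩
    ext s
    rw [hkey, charFun_cauchyMeasure _ hγ0, ← hγ]

theorem proposition6p4 (α : Measure ℝ) (hα : α ∈ FT1) (b c : ℝ) (hb : 0 ≤ b) (hbc : b < c)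
    (ν : Measure ℝ) (hν : ∀ a ∈ Set.Ioo b c, dirichletMean a α = ν) :
    α = ν ∧
      ((∃ (x₀ : ℝ) (γ : ℝ≥0), 0 < γ ∧ ν = cauchyMeasure x₀ γ) ∨
        ∃ x₀ : ℝ, ν = Measure.dirac x₀) := by
  have := hα.1
  have hνp : IsProbabilityMeasure ν := by
    obtain ⟨a, ha⟩ := exists_between hbc
    rw [← hν a ha]
    exact isProbabilityMeasure_dirichletMean (hb.trans_lt ha.1) hα
  have hmul := fun s y hy => charFun_mul_charFun_of_dirichletMean_eq hα hb hbc hν s (y := y) hy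
  have hαν : α = ν := by
    refine Measure.ext_of_charFun (funext fun s => ?_)
    simpa [charFun_zero] using hmul s 1 (by simp)
  refine ⟨hαν, eq_cauchyMeasure_or_dirac_of_charFun_add fun s t hs ht => ?_⟩
  -- The fraction `y = s / (s + t)` splits `s + t` into `s` and `t`, except when both are 0.
  rcases (add_nonneg hs ht).eq_or_lt with h | h
  · have hs0 : s = 0 := by linarith
    have ht0 : t = 0 := by linarith
    simp [hs0, ht0, charFun_zero]
  · have := hmul (s + t) (s / (s + t)) ⟨by positivity, by rw [div_le_one h]; linarith⟩
    rw [hαν, mul_div_cancel₀ _ h.ne', one_sub_div h.ne', add_sub_cancel_left,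
      mul_div_cancel₀ _ h.ne'] at this
    exact this.symm
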